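/- Let $\alpha=(\alpha_1,\dots,\alpha_k)$ be a composition of $n$, and draw its diagram as a left-justified array of cells whose $i$-th row from the top has $\alpha_i$ cells. For a word $w=w_1\cdots w_m$ of positive integers, let $\mathrm{stan}(w)$ be the unique permutation $\sigma$ of $\{1,\dots,m\}$ such that, for all $i<j$, $\sigma(i)>\sigma(j)$ if and only if $w_i>w_j$. Let $\mathrm{SPCT}(\alpha)$ be the set of fillings $\tau$ of the diagram of $\alpha$ with the numbers $1,\dots,n$, each used once, such that the rows decrease from left to right and the following triple condition holds: whenever $a$ is the entry of a cell $(r,c)$ and $c'$ is the entry of a cell $(r',c+1)$ with $r<r'$ (that is, in the next column and a strictly lower row), and $a>c'$, then the cell $(r,c+1)$ belongs to the diagram and its entry $b$ satisfies $b>c'$. (The type of $\tau$ is the standardization of its first column read from top to bottom; tableaux of all types are included.) For $\tau\in\mathrm{SPCT}(\alpha)$ let $\mathrm{st}(\tau)$ be the concatenation, over the columns from left to right, of the standardizations (in one-line notation) of the words obtained by reading each column from top to bottom. Put $\tau_1\sim_\alpha\tau_2$ if $\mathrm{st}(\tau_1)=\mathrm{st}(\tau_2)$; this is an equivalence relation on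 $\mathrm{SPCT}(\alpha)$. An integer $1\le i\le n-1$ is a descent of $\tau$ if $i+1$ lies in the same column as $i$ or in a column further right. The integers $i$ and $i+1$ are attacking in $\tau$ if they lie in the same column, or if $i+1$ lies in the column immediately to the right of the column of $i$ and in a strictly lower row than $i$. The tableau $\tau$ is a source tableau if for every $1\le i\le n-1$ that is not a descent, $i+1$ lies in the cell immediately to the left of $i$. It is a sink tableau if for every descent $i$, the integers $i$ and $i+1$ are attacking. Then every equivalence class under $\sim_\alpha$ contains exactly one source tableau and exactly one sink tableau. -/

import Mathlib

namespace PermutedTableaux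

/-- The standardization of a word `w = w₁ ⋯ wₖ`: the permutation that ranks the letters of `w`
by size, equal letters being ranked from left to right. (`Tuple.sort` is the stable sorting
permutation.) The lemma `stan_lt_stan_iff` is the usual characterization. -/
def stan {k : ℕ} (w : Fin k → ℕ) : Equiv.Perm (Fin k) := (Tuple.sort w)⁻¹

theorem stan_lt_stan_iff {k : ℕ} (w : Fin k → ℕ) {i j : Fin k} (hij : i < j) :
    stan w j < stan w i ↔ w j < w i := by
  have hs := (Tuple.eq_sort_iff (f := w) (σ := Tuple.sort w)).1 rfl
  have key : ∀ a : Fin k, Tuple.sort w (stan w a) = a := fun a => by simp [stan]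
  constructor
  · intro h
    have h1 : w j ≤ w i := by
      have := hs.1 h.le
      simpa [Function.comp, key] using this
    rcases h1.lt_or_eq with h2 | h2
    · exact h2
    · have := hs.2 _ _ h (by rw [key, key]; exact h2)
      rw [key, key] at this
      exact absurd this (not_lt.2 hij.le)
  · intro h
    by_contra hc
    have := hs.1 (not_lt.1 hc)
    simp only [Function.comp, key] at this
    exact absurd h (not_lt.2 this)

/-- One-line notation of a permutation, as a word in the letters `1, …, k`. -/
def oneLine {k : ℕ} (σ : Equiv.Perm (Fin k)) : List ℕ :=
  List.ofFn fun i => (σ i : ℕ) + 1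

/-- The standardization of a word, as a word (in one-line notation). -/
def stanWord (w : List ℕ) : List ℕ := oneLine (stan w.get)

variable {n : ℕ}

/-- The cell in row `r` and column `c` (both counted from `0`, rows from top to bottom) belongs to
the composition diagram of `α`. -/
def InDiagram (α : Composition n) (r c : ℕ) : Prop := c < α.blocks.getD r 0

instance (α : Composition n) (r c : ℕ) : Decidable (InDiagram α r c) :=
  inferInstanceAs (Decidable (c < α.blocks.getD r 0))

/-- A filling of the composition diagram of `α` with positive integers; the value `0` is
prescribed outside the diagram, so that a filling is determined by its entries in the diagram. -/
@[ext]
structure Filling (α : Composition n) where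
  entry : ℕ → ℕ → ℕ
  pos : ∀ r c, InDiagram α r c → 0 < entry r c
  zero : ∀ r c, ¬ InDiagram α r c → entry r c = 0

namespace Filling

variable {α : Composition n} (τ : Filling α)

/-- The word formed by the entries of column `c`, read from top to bottom. -/
def colWord (c : ℕ) : List ℕ :=
  ((List.range α.length).filter fun r => InDiagram α r c).map fun r => τ.entry r c

/-- `τ` is a permuted composition tableau of shape `α` and type `σ`. In the triple condition
the cell of `b` (right of `a`) is required to belong to the diagram when `a ≥ c`; equivalently, a
missing `b` counts as `0`. -/
structure IsPCT (σ : Equiv.Perm (Fin α.length)) : Prop where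
  firstCol_nodup : (τ.colWord 0).Nodup
  firstCol_stan : stanWord (τ.colWord 0) = oneLine σ
  row_weak : ∀ r c c', c ≤ c' → InDiagram α r c' → τ.entry r c' ≤ τ.entry r c
  triple : ∀ r r' c, r < r' → InDiagram α r c → InDiagram α r' (c + 1) →
    τ.entry r' (c + 1) ≤ τ.entry r c →
      InDiagram α r (c + 1) ∧ τ.entry r' (c + 1) < τ.entry r (c + 1)

/-- `τ` is a standard permuted composition tableau of shape `α` and type `σ`: its entries are
at most `n = |α|` and all distinct. -/
structure IsSPCT (σ : Equiv.Perm (Fin α.length)) : Prop extends τ.IsPCT σ where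
  le_size : ∀ r c, InDiagram α r c → τ.entry r c ≤ n
  distinct : ∀ r c r' c', InDiagram α r c → InDiagram α r' c' →
    τ.entry r c = τ.entry r' c' → r = r' ∧ c = c'

/-- The number `v` is the entry of the cell `(r, c)` of the diagram. -/
def At (v r c : ℕ) : Prop := InDiagram α r c ∧ τ.entry r c = v

/-- The standardized column word `st(τ) = st₁(τ) st₂(τ) ⋯ st_{αmax}(τ)`. -/
def st : List ℕ :=
  (List.range (Finset.univ.sup α.blocksFun)).flatMap fun c => stanWord (τ.colWord c)

/-- The descent set: `1 ≤ i ≤ n - 1` is a descent if `i + 1` lies weakly right of `i`. -/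
def des : Set ℕ :=
  {i | 1 ≤ i ∧ i + 1 ≤ n ∧ ∃ r c r' c', τ.At i r c ∧ τ.At (i + 1) r' c' ∧ c ≤ c'}

/-- `i` and `i + 1` are attacking: they lie in the same column, or `i + 1` lies in the column
just right of that of `i` and in a strictly lower row. -/
def Attacking (i : ℕ) : Prop :=
  ∃ r c r' c', τ.At i r c ∧ τ.At (i + 1) r' c' ∧ (c = c' ∨ (c' = c + 1 ∧ r < r'))

/-- Source: for every non-descent `i ≠ n`, `i + 1` lies immediately left of `i`. -/
def IsSource : Prop :=
  ∀ i, 1 ≤ i → i + 1 ≤ n → i ∉ τ.des → ∃ r c, τ.At (i + 1) r c ∧ τ.At i r (c + 1)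

/-- Sink: for every descent `i`, `i` and `i + 1` are attacking. -/
def IsSink : Prop := ∀ i ∈ τ.des, τ.Attacking i

end Filling

/-- The set `SPCT(α)` of standard permuted composition tableaux of shape `α`, of any type.
(The type is determined by the filling, so the union over the types is disjoint.) -/
def SPCT (α : Composition n) : Type :=
  {τ : Filling α // ∃ σ : Equiv.Perm (Fin α.length), τ.IsSPCT σ}

/-- The equivalence relation `∼_α` on `SPCT(α)`: equality of standardized column words. -/
def stSetoid (α : Composition n) : Setoid (SPCT α) where
  r τ₁ τ₂ := τ₁.1.st = τ₂.1.st
  iseqv := ⟨fun _ => rfl, fun h => h.symm, fun h h' => h.trans h'⟩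

end PermutedTableaux

/-!
Fix a tableau `τ₀`. Prescribing the relative order of the entries in every column turns the triple
condition into a list of inequalities: for a cell `(r, c)` and a cell `(r', c + 1)` with `r < r'`,
the entry of the former exceeds that of the latter exactly when the entry of `(r, c + 1)` does, and
this is a comparison within a column. Hence the tableaux equivalent to `τ₀` are exactly the linear
extensions of one relation `Forced τ₀` on the cells, generated by the row steps, the column
comparisons and the comparisons between a cell and the lower cells of the next column
(`colOrder_iff_forced`, `isSPCT_ofLabelling`).

In these terms a sink is a linear extension without consecutive values `i`, `i + 1` at two
unrelated cells with `i` strictly further left, and a source is the same with left and right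
exchanged (`isSink_iff`, `isSource_iff`). So both halves are instances of one fact about a
relation `G` on a finite set with a column function, for which each column is a chain and no step
of `G` goes up by more than one column: there is exactly one such extension
(`existsUnique_extremal`).

Existence: minimize `∑ x, e x * col x`; a forbidden consecutive pair could be exchanged,
decreasing the sum. Uniqueness: a `G`-path from `x` up to `z` meets every column between
those of `x` and `z`, and columns are chains, so each cell in such a column is comparable to `x` or
to `z`. By induction on the difference of the values, this makes any pair `x`, `y` with
`e x < e y` and `col x < col y` comparable, not only consecutive ones
(`transGen_of_lt`). The order of the values is therefore determined by `G` and `col`.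
-/

namespace PermutedTableaux

/-! ### Linear extensions of a relation on a set with columns -/

section Extremal

open Relation

variable {C : Type*} {n : ℕ} {col : C → ℤ} {G : C → C → Prop}

/-- A path whose steps go up by at most one column meets all intermediate columns. -/
theorem exists_mem_col_of_reflTransGen (hstep : ∀ x y, G x y → col y ≤ col x + 1) {x z : C}
    (h : ReflTransGen G x z) {c : ℤ} (hx : col x ≤ c) (hz : c ≤ col z) :
    ∃ w, col w = c ∧ ReflTransGen G x w ∧ ReflTransGen G w z := by
  induction h using ReflTransGen.head_induction_on with
  | refl => exact ⟨z, le_antisymm hx hz, .refl, .refl⟩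
  | @head a b hab hbz ih =>
    rcases hx.eq_or_lt with hc | hc
    · exact ⟨a, hc, .refl, .head hab hbz⟩
    · obtain ⟨w, hw, h1, h2⟩ := ih (by have := hstep _ _ hab; omega)
      exact ⟨w, hw, .head hab h1, h2⟩

theorem lt_of_transGen {e : C ≃ Fin n} (hmono : ∀ x y, G x y → e x < e y) {x y : C}
    (h : TransGen G x y) : e x < e y := by
  induction h with
  | single h => exact hmono _ _ h
  | tail _ h ih => exact ih.trans (hmono _ _ h)

/-- A condition on consecutive values propagates to all values: if consecutive values in increasing
columns are always related, then arbitrary increasing values in increasing columns are comparable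
in the order generated by `G`. -/
theorem transGen_of_lt (hchain : ∀ x y, col x = col y → x ≠ y → G x y ∨ G y x)
    (hstep : ∀ x y, G x y → col y ≤ col x + 1) {e : C ≃ Fin n}
    (hmono : ∀ x y, G x y → e x < e y)
    (hext : ∀ x y, (e y : ℕ) = e x + 1 → col x < col y → G x y) (x y : C)
    (hxy : e x < e y) (hcol : col x < col y) : TransGen G x y := by
  induction hd : (e y : ℕ) - e x using Nat.strong_induction_on generalizing x y with
  | _ d ih =>
  by_cases hsucc : (e y : ℕ) = e x + 1
  · exact .single (hext x y hsucc hcol)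
  have hlt : (e x : ℕ) < e y := hxy
  obtain ⟨z, hz⟩ : ∃ z, (e z : ℕ) = e x + 1 :=
    ⟨e.symm ⟨e x + 1, by have := (e y).isLt; omega⟩, by simp⟩
  have hxz : e x < e z := by rw [Fin.lt_def]; omega
  have hzy : e z < e y := by rw [Fin.lt_def]; omega
  rcases lt_or_ge (col z) (col y) with hzc | hzc
  · have zy : TransGen G z y := ih _ (by omega) z y hzy hzc rfl
    rcases lt_or_ge (col x) (col z) with hxc | hxc
    · exact (ih _ (by omega) x z hxz hxc rfl).trans zy
    · -- The path from `z` to `y` crosses the column of `x`.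
      obtain ⟨w, hw, zw, wy⟩ :=
        exists_mem_col_of_reflTransGen hstep zy.to_reflTransGen hxc hcol.le
      rcases eq_or_ne x w with rfl | hne
      · rcases reflTransGen_iff_eq_or_transGen.1 wy with h | h
        · exact absurd hcol (by simp [h])
        · exact h
      · rcases hchain x w hw.symm hne with h | h
        · exact TransGen.head' h wy
        · exact absurd (lt_of_transGen hmono (TransGen.tail' zw h)) hxz.not_gt
  · -- The path from `x` to `z` crosses the column of `y`.
    have xz : TransGen G x z := ih _ (by omega) x z hxz (hcol.trans_le hzc) rfl
    obtain ⟨w, hw, xw, wz⟩ :=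
      exists_mem_col_of_reflTransGen hstep xz.to_reflTransGen hcol.le hzc
    rcases eq_or_ne y w with rfl | hne
    · rcases reflTransGen_iff_eq_or_transGen.1 xw with h | h
      · exact absurd hcol (by simp [h])
      · exact h
    · rcases hchain y w hw.symm hne with h | h
      · exact absurd (lt_of_transGen hmono (TransGen.head' h wz)) hzy.not_gt
      · exact TransGen.tail' xw h

theorem eq_of_extremal (hchain : ∀ x y, col x = col y → x ≠ y → G x y ∨ G y x)
    (hstep : ∀ x y, G x y → col y ≤ col x + 1) {e e' : C ≃ Fin n}
    (hmono : ∀ x y, G x y → e x < e y)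
    (hext : ∀ x y, (e y : ℕ) = e x + 1 → col x < col y → G x y)
    (hmono' : ∀ x y, G x y → e' x < e' y)
    (hext' : ∀ x y, (e' y : ℕ) = e' x + 1 → col x < col y → G x y) : e = e' := by
  have key : ∀ x y, e x < e y → e' x < e' y := by
    intro x y h
    rcases lt_trichotomy (col x) (col y) with hc | hc | hc
    · exact lt_of_transGen hmono' (transGen_of_lt hchain hstep hmono hext x y h hc)
    · have hne : x ≠ y := by rintro rfl; exact lt_irrefl _ h
      rcases hchain x y hc hne with hG | hG
      · exact hmono' _ _ hG
      · exact absurd (hmono _ _ hG) h.not_gt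
    · by_contra hn
      have hne : e' y ≠ e' x := fun h' => by
        rw [e'.injective h'] at h; exact lt_irrefl _ h
      have := transGen_of_lt hchain hstep hmono' hext' y x (lt_of_le_of_ne (not_lt.1 hn) hne) hc
      exact absurd (lt_of_transGen hmono this) h.not_gt
  have hs : StrictMono (e' ∘ e.symm) := fun a b hab => key _ _ (by simpa using hab)
  have hid := Subsingleton.elim
    (hs.orderIsoOfSurjective _ (e'.surjective.comp e.symm.surjective)) (OrderIso.refl (Fin n))
  ext x
  have := congrArg (fun f : Fin n ≃o Fin n => f (e x)) hid
  simp only [StrictMono.coe_orderIsoOfSurjective, Function.comp, Equiv.symm_apply_apply,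
    OrderIso.refl_apply] at this
  rw [this]

theorem exists_extremal [Fintype C] (G : C → C → Prop) (col : C → ℤ)
    (hne : ∃ e : C ≃ Fin n, ∀ x y, G x y → e x < e y) :
    ∃ e : C ≃ Fin n, (∀ x y, G x y → e x < e y) ∧
      ∀ x y, (e y : ℕ) = e x + 1 → col x < col y → G x y := by
  classical
  obtain ⟨e₀, he₀⟩ := hne
  have : Nonempty {e : C ≃ Fin n // ∀ x y, G x y → e x < e y} := ⟨⟨e₀, he₀⟩⟩
  obtain ⟨⟨e, he⟩, hmin⟩ := Finite.exists_min
    fun e : {e : C ≃ Fin n // ∀ x y, G x y → e x < e y} => ∑ x, ((e.1 x : ℕ) : ℤ) * col x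
  refine ⟨e, he, fun x y hxy hcol => ?_⟩
  -- Otherwise exchanging the values at `x` and `y` gives an extension with a smaller sum.
  by_contra hG
  have hne : x ≠ y := by rintro rfl; exact lt_irrefl _ hcol
  have val : ∀ z, ((Equiv.swap (e x) (e y) (e z) : ℕ) : ℤ) =
      (e z : ℕ) + (if z = x then 1 else 0) - (if z = y then 1 else 0) := by
    intro z
    by_cases h1 : z = x
    · subst h1; rw [Equiv.swap_apply_left, hxy]; simp [hne]
    by_cases h2 : z = y
    · subst h2; rw [Equiv.swap_apply_right, hxy]; simp [h1]
    rw [Equiv.swap_apply_of_ne_of_ne (by simpa using h1) (by simpa using h2)]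
    simp [h1, h2]
  have hswap : ∀ a b, G a b →
      (e.trans (Equiv.swap (e x) (e y))) a < (e.trans (Equiv.swap (e x) (e y))) b := by
    intro a b hab
    have hlt : (e a : ℕ) < e b := he a b hab
    have ha := val a
    have hb := val b
    have hax : (e a : ℕ) = e x ↔ a = x := by rw [← Fin.ext_iff, e.injective.eq_iff]
    have hay : (e a : ℕ) = e y ↔ a = y := by rw [← Fin.ext_iff, e.injective.eq_iff]
    have hbx : (e b : ℕ) = e x ↔ b = x := by rw [← Fin.ext_iff, e.injective.eq_iff]
    have hby : (e b : ℕ) = e y ↔ b = y := by rw [← Fin.ext_iff, e.injective.eq_iff]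
    have hnot : ¬ (a = x ∧ b = y) := by rintro ⟨rfl, rfl⟩; exact hG hab
    simp only [← hax, ← hay, ← hbx, ← hby] at ha hb hnot
    rw [Fin.lt_def, Equiv.trans_apply, Equiv.trans_apply]
    split_ifs at ha hb <;> omega
  have := hmin ⟨_, hswap⟩
  simp only [Equiv.trans_apply, val, sub_mul, add_mul, Finset.sum_sub_distrib,
    Finset.sum_add_distrib, ite_mul, one_mul, zero_mul, Finset.sum_ite_eq', Finset.mem_univ,
    if_true] at this
  omega

/-- If each column is a chain for `G` and steps of `G` go up by at most one column, then exactly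
one linear extension of `G` has no consecutive values at unrelated points of increasing columns. -/
theorem existsUnique_extremal [Fintype C] (hchain : ∀ x y, col x = col y → x ≠ y → G x y ∨ G y x)
    (hstep : ∀ x y, G x y → col y ≤ col x + 1)
    (hne : ∃ e : C ≃ Fin n, ∀ x y, G x y → e x < e y) :
    ∃! e : C ≃ Fin n, (∀ x y, G x y → e x < e y) ∧
      ∀ x y, (e y : ℕ) = e x + 1 → col x < col y → G x y := by
  obtain ⟨e, he⟩ := exists_extremal G col hne
  exact ⟨e, he, fun e' he' => eq_of_extremal hchain hstep he'.1 he'.2 he.1 he.2⟩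

end Extremal

/-! ### Standardization and relative order -/

theorem stanWord_ofFn {k : ℕ} (w : Fin k → ℕ) : stanWord (List.ofFn w) = oneLine (stan w) := by
  have key : ∀ (l : List ℕ) (h : k = l.length), (∀ i, w i = l.get (i.cast h)) →
      stanWord l = oneLine (stan w) := by
    rintro l rfl hw
    have : w = l.get := funext fun i => hw i
    rw [this, stanWord]
  exact key _ (by simp) (by simp)

theorem oneLine_injective {k : ℕ} : Function.Injective (oneLine (k := k)) := by
  intro σ τ h
  have := List.ofFn_injective h
  ext i
  simpa using congrFun this i

/-- Two injective words have the same standardization if and only if they have the same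
relative order. -/
theorem stan_eq_stan_iff {k : ℕ} {v w : Fin k → ℕ} (hv : Function.Injective v)
    (hw : Function.Injective w) : stan v = stan w ↔ ∀ i j, v i < v j → w i < w j := by
  constructor
  · intro h i j hij
    rcases lt_trichotomy i j with hlt | rfl | hlt
    · by_contra hn
      have hne : w j ≠ w i := fun h' => hlt.ne (hw h').symm
      have := (stan_lt_stan_iff w hlt).2 (lt_of_le_of_ne (not_lt.1 hn) hne)
      rw [← h, stan_lt_stan_iff v hlt] at this
      exact absurd this hij.not_gt
    · exact absurd hij (lt_irrefl _)
    · rw [← stan_lt_stan_iff w hlt, ← h, stan_lt_stan_iff v hlt]; exact hij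
  · intro h
    unfold stan
    congr 1
    refine Tuple.eq_sort_iff.2 ⟨fun a b hab => ?_, fun i j hij heq => ?_⟩
    · rcases ((Tuple.monotone_sort v) hab).eq_or_lt with he | hl
      · exact (congrArg w (hv he)).le
      · exact (h _ _ hl).le
    · exact absurd ((Tuple.sort v).injective (hw heq)) hij.ne

theorem stanWord_map_eq_iff {L : List ℕ} (hL : L.Nodup) {f g : ℕ → ℕ}
    (hf : ∀ r ∈ L, ∀ s ∈ L, f r = f s → r = s) (hg : ∀ r ∈ L, ∀ s ∈ L, g r = g s → r = s) :
    stanWord (L.map f) = stanWord (L.map g) ↔ ∀ r ∈ L, ∀ s ∈ L, f r < f s → g r < g s := by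
  have ofFn : ∀ f : ℕ → ℕ, L.map f = List.ofFn fun i : Fin L.length => f (L.get i) := by
    intro f
    conv_lhs => rw [← List.ofFn_get L, List.map_ofFn]
    rfl
  have inj : ∀ f : ℕ → ℕ, (∀ r ∈ L, ∀ s ∈ L, f r = f s → r = s) →
      Function.Injective fun i : Fin L.length => f (L.get i) := fun f hf i j hij =>
    hL.injective_get (hf _ (L.get_mem i) _ (L.get_mem j) hij)
  rw [ofFn f, ofFn g, stanWord_ofFn, stanWord_ofFn, oneLine_injective.eq_iff,
    stan_eq_stan_iff (inj f hf) (inj g hg)]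
  constructor
  · intro h r hr s hs
    obtain ⟨i, rfl⟩ := List.get_of_mem hr
    obtain ⟨j, rfl⟩ := List.get_of_mem hs
    exact h i j
  · intro h i j
    exact h _ (L.get_mem i) _ (L.get_mem j)

theorem length_stanWord (w : List ℕ) : (stanWord w).length = w.length := by
  simp [stanWord, oneLine]

theorem flatMap_eq_flatMap_iff {ι β : Type*} {L : List ι} {f g : ι → List β}
    (hlen : ∀ i ∈ L, (f i).length = (g i).length) :
    L.flatMap f = L.flatMap g ↔ ∀ i ∈ L, f i = g i := by
  induction L with
  | nil => simp
  | cons a L ih =>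
    simp only [List.mem_cons, forall_eq_or_imp] at hlen ⊢
    rw [List.flatMap_cons, List.flatMap_cons, ← ih hlen.2]
    exact ⟨fun h => List.append_inj h hlen.1, fun h => by rw [h.1, h.2]⟩

/-! ### Cells of the diagram -/

variable {n : ℕ} {α : Composition n}

theorem InDiagram.lt_length {r c : ℕ} (h : InDiagram α r c) : r < α.length := by
  by_contra hr
  rw [InDiagram, List.getD_eq_default _ _ (not_lt.1 hr)] at h
  exact absurd h (Nat.not_lt_zero _)

theorem InDiagram.mono {r c c' : ℕ} (h : InDiagram α r c') (hc : c ≤ c') : InDiagram α r c :=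
  lt_of_le_of_lt hc h

theorem inDiagram_iff_of_lt {r c : ℕ} (hr : r < α.length) :
    InDiagram α r c ↔ c < α.blocksFun ⟨r, hr⟩ := by
  rw [InDiagram, List.getD_eq_getElem _ _ hr]
  rfl

theorem InDiagram.lt_sup {r c : ℕ} (h : InDiagram α r c) :
    c < Finset.univ.sup α.blocksFun :=
  lt_of_lt_of_le ((inDiagram_iff_of_lt h.lt_length).1 h)
    (Finset.le_sup (f := α.blocksFun) (Finset.mem_univ _))

/-- The cells of the composition diagram of `α`, as pairs of a row and a column. -/
abbrev Cell (α : Composition n) : Type := {p : ℕ × ℕ // InDiagram α p.1 p.2}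

/-- The cells, row by row. -/
def cellEquiv (α : Composition n) : Cell α ≃ Σ i : Fin α.length, Fin (α.blocksFun i) where
  toFun x := ⟨⟨x.1.1, x.2.lt_length⟩, ⟨x.1.2, (inDiagram_iff_of_lt x.2.lt_length).1 x.2⟩⟩
  invFun y := ⟨(y.1, y.2), (inDiagram_iff_of_lt y.1.isLt).2 y.2.isLt⟩
  left_inv _ := rfl
  right_inv _ := rfl

instance (α : Composition n) : Fintype (Cell α) := Fintype.ofEquiv _ (cellEquiv α).symm

theorem card_cell (α : Composition n) : Fintype.card (Cell α) = n := by
  rw [Fintype.card_congr ((cellEquiv α).trans α.blocksFinEquiv), Fintype.card_fin]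

/-! ### Tableaux as labellings of the cells -/

namespace Filling

variable {τ τ₀ : Filling α}

/-- The entry in a cell. -/
def val (τ : Filling α) (x : Cell α) : ℕ := τ.entry x.1.1 x.1.2

theorem IsSPCT.val_injective {σ : Equiv.Perm (Fin α.length)} (h : τ.IsSPCT σ) :
    Function.Injective τ.val := fun x y hxy =>
  have := h.distinct _ _ _ _ x.2 y.2 hxy
  Subtype.ext (Prod.ext this.1 this.2)

/-- A standard tableau as a bijection of the cells onto `Fin n`: the label of a cell is its entry
minus one. -/
noncomputable def labelling {σ : Equiv.Perm (Fin α.length)} (h : τ.IsSPCT σ) : Cell α ≃ Fin n :=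
  Equiv.ofBijective (fun x => ⟨τ.val x - 1, by
      have h1 : 0 < τ.val x := τ.pos _ _ x.2
      have h2 : τ.val x ≤ n := h.le_size _ _ x.2
      omega⟩) <| by
    rw [Fintype.bijective_iff_injective_and_card, card_cell, Fintype.card_fin]
    refine ⟨fun x y hxy => h.val_injective ?_, rfl⟩
    have h1 : 0 < τ.val x := τ.pos _ _ x.2
    have h2 : 0 < τ.val y := τ.pos _ _ y.2
    have h3 := Fin.ext_iff.1 hxy
    simp only at h3
    omega

theorem labelling_add_one {σ : Equiv.Perm (Fin α.length)} (h : τ.IsSPCT σ) (x : Cell α) :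
    (labelling h x : ℕ) + 1 = τ.val x := by
  have h1 : 0 < τ.val x := τ.pos _ _ x.2
  simp only [labelling, Equiv.ofBijective_apply]
  omega

/-- The filling whose entry in a cell is the label of the cell plus one. -/
def ofLabelling (e : Cell α ≃ Fin n) : Filling α where
  entry r c := if h : InDiagram α r c then (e ⟨(r, c), h⟩ : ℕ) + 1 else 0
  pos r c h := by simp [h]
  zero r c h := by simp [h]

theorem val_ofLabelling (e : Cell α ≃ Fin n) (x : Cell α) :
    (ofLabelling e).val x = (e x : ℕ) + 1 := by
  simp [val, ofLabelling, x.2]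

theorem ext_val (h : ∀ x, τ.val x = τ₀.val x) : τ = τ₀ := by
  ext r c
  by_cases hc : InDiagram α r c
  · exact h ⟨(r, c), hc⟩
  · rw [τ.zero _ _ hc, τ₀.zero _ _ hc]

/-- The entries of `τ` and `τ₀` are in the same relative order in every column. -/
def ColOrder (τ₀ τ : Filling α) : Prop :=
  ∀ x y : Cell α, x.1.2 = y.1.2 → τ₀.val x < τ₀.val y → τ.val x < τ.val y

theorem ColOrder.symm (h₀ : Function.Injective τ₀.val) (h : ColOrder τ₀ τ) : ColOrder τ τ₀ := by
  intro x y hxy hlt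
  have hne : τ₀.val x ≠ τ₀.val y := fun h' => by
    rw [h₀ h'] at hlt; exact lt_irrefl _ hlt
  exact hne.lt_or_gt.resolve_right fun h' => absurd (h y x hxy.symm h') hlt.not_gt

theorem stanWord_colWord_eq_iff (h₀ : Function.Injective τ₀.val) (hτ : Function.Injective τ.val)
    (c : ℕ) : stanWord (τ₀.colWord c) = stanWord (τ.colWord c) ↔
      ∀ x y : Cell α, x.1.2 = c → y.1.2 = c → τ₀.val x < τ₀.val y → τ.val x < τ.val y := by
  have mem : ∀ r, r ∈ (List.range α.length).filter (fun r => InDiagram α r c) ↔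
      InDiagram α r c := fun r => by
    simp only [List.mem_filter, List.mem_range, decide_eq_true_eq]
    exact ⟨fun h => h.2, fun h => ⟨h.lt_length, h⟩⟩
  have inj : ∀ τ : Filling α, Function.Injective τ.val → ∀ r, InDiagram α r c →
      ∀ s, InDiagram α s c → τ.entry r c = τ.entry s c → r = s := fun τ hτ r hr s hs h =>
    congrArg (fun x : Cell α => x.1.1) (@hτ ⟨(r, c), hr⟩ ⟨(s, c), hs⟩ h)
  rw [colWord, colWord, stanWord_map_eq_iff (List.nodup_range.filter _)
    (by simpa only [mem] using inj τ₀ h₀) (by simpa only [mem] using inj τ hτ)]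
  simp only [mem]
  constructor
  · rintro h ⟨⟨r, _⟩, hx⟩ ⟨⟨s, _⟩, hy⟩ rfl rfl
    exact h r hx s hy
  · intro h r hr s hs
    exact h ⟨(r, c), hr⟩ ⟨(s, c), hs⟩ rfl rfl

theorem st_eq_iff (h₀ : Function.Injective τ₀.val) (hτ : Function.Injective τ.val) :
    τ₀.st = τ.st ↔ ColOrder τ₀ τ := by
  rw [st, st, flatMap_eq_flatMap_iff (by simp [length_stanWord, colWord])]
  simp only [stanWord_colWord_eq_iff h₀ hτ, List.mem_range]
  exact ⟨fun h x y hxy => h _ y.2.lt_sup x y hxy rfl,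
    fun h c _ x y hx hy => h x y (hx.trans hy.symm)⟩

/-! ### The relation describing an equivalence class -/

/-- The inequalities satisfied by all tableaux equivalent to `τ₀`: the entry of `x` is smaller than
that of `y` if `x` is the right neighbour of `y`, or if this holds in `τ₀` and `y` lies in the
column of `x` or strictly lower in the next column. -/
def Forced (τ₀ : Filling α) (x y : Cell α) : Prop :=
  (x.1.1 = y.1.1 ∧ x.1.2 = y.1.2 + 1) ∨
    (τ₀.val x < τ₀.val y ∧ (x.1.2 = y.1.2 ∨ (y.1.2 = x.1.2 + 1 ∧ x.1.1 < y.1.1)))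

variable {σ σ₀ : Equiv.Perm (Fin α.length)}

/-- The comparison of a cell with a lower cell of the next column depends only on the relative
orders within the columns, by the triple condition. -/
theorem lt_of_colOrder (h₀ : τ₀.IsSPCT σ₀) (hτ : τ.IsSPCT σ) (h : ColOrder τ₀ τ) {x y : Cell α}
    (hc : y.1.2 = x.1.2 + 1) (hr : x.1.1 < y.1.1) (hlt : τ₀.val x < τ₀.val y) :
    τ.val x < τ.val y := by
  obtain ⟨⟨r, c⟩, hx⟩ := x
  obtain ⟨⟨r', d⟩, hy⟩ := y
  obtain rfl : d = c + 1 := hc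
  by_contra hn
  obtain ⟨hb, hbl⟩ := hτ.triple r r' c hr hx hy (not_lt.1 hn)
  have hbl' : τ₀.entry r' (c + 1) < τ₀.entry r (c + 1) :=
    h.symm h₀.val_injective ⟨(r', c + 1), hy⟩ ⟨(r, c + 1), hb⟩ rfl hbl
  have hrow := h₀.row_weak r c (c + 1) (Nat.le_succ c) hb
  exact absurd (hbl'.trans_le hrow) hlt.not_gt

theorem colOrder_iff_forced (h₀ : τ₀.IsSPCT σ₀) (hτ : τ.IsSPCT σ) :
    ColOrder τ₀ τ ↔ ∀ x y, Forced τ₀ x y → τ.val x < τ.val y := by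
  constructor
  · rintro h x y (⟨hr, hc⟩ | ⟨hlt, hc | ⟨hc, hr⟩⟩)
    · have hle : τ.val x ≤ τ.val y := by
        have := hτ.row_weak x.1.1 y.1.2 x.1.2 (by omega) x.2
        unfold val
        rw [hr] at this ⊢
        exact this
      refine lt_of_le_of_ne hle fun h' => ?_
      rw [hτ.val_injective h'] at hc
      omega
    · exact h x y hc hlt
    · exact lt_of_colOrder h₀ hτ h hc hr hlt
  · exact fun h x y hxy hlt => h x y (.inr ⟨hlt, .inl hxy⟩)

theorem le_of_forall_succ_lt {r : ℕ}
    (h : ∀ c, InDiagram α r (c + 1) → τ.entry r (c + 1) < τ.entry r c) {c c' : ℕ} (hc : c ≤ c')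
    (hd : InDiagram α r c') : τ.entry r c' ≤ τ.entry r c := by
  induction c', hc using Nat.le_induction with
  | base => exact le_rfl
  | succ k _ ih => exact (h k hd).le.trans (ih (hd.mono k.le_succ))

theorem val_ofLabelling_injective (e : Cell α ≃ Fin n) :
    Function.Injective (ofLabelling e).val := fun x y h => by
  rw [val_ofLabelling, val_ofLabelling] at h
  exact e.injective (Fin.ext (by omega))

theorem isSPCT_ofLabelling (h₀ : τ₀.IsSPCT σ₀) {e : Cell α ≃ Fin n}
    (he : ∀ x y, Forced τ₀ x y → e x < e y) :
    (ofLabelling e).IsSPCT σ₀ ∧ ColOrder τ₀ (ofLabelling e) := by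
  have hF : ∀ x y, Forced τ₀ x y → (ofLabelling e).val x < (ofLabelling e).val y := fun x y h => by
    rw [val_ofLabelling, val_ofLabelling]
    exact Nat.succ_lt_succ (he x y h)
  have inj := val_ofLabelling_injective e
  have hcol : ColOrder τ₀ (ofLabelling e) := fun x y hxy hlt => hF x y (.inr ⟨hlt, .inl hxy⟩)
  refine ⟨⟨⟨?_, ?_, ?_, ?_⟩, ?_, ?_⟩, hcol⟩
  · refine List.Nodup.map_on (fun r hr s hs h => ?_) (List.nodup_range.filter _)
    simp only [List.mem_filter, decide_eq_true_eq] at hr hs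
    exact congrArg (fun x : Cell α => x.1.1) (@inj ⟨(r, 0), hr.2⟩ ⟨(s, 0), hs.2⟩ h)
  · rw [← h₀.firstCol_stan]
    exact ((stanWord_colWord_eq_iff h₀.val_injective inj 0).2
      fun x y hx hy => hcol x y (hx.trans hy.symm)).symm
  · intro r c c' hc hd
    exact le_of_forall_succ_lt (fun k hk =>
      hF ⟨(r, k + 1), hk⟩ ⟨(r, k), hk.mono k.le_succ⟩ (.inl ⟨rfl, rfl⟩)) hc hd
  · intro r r' c hr hx hy hle
    have h1 : τ₀.entry r' (c + 1) ≤ τ₀.entry r c := not_lt.1 fun hlt =>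
      absurd (hF ⟨(r, c), hx⟩ ⟨(r', c + 1), hy⟩ (.inr ⟨hlt, .inr ⟨rfl, hr⟩⟩)) (not_lt.2 hle)
    obtain ⟨hb, hbl⟩ := h₀.triple r r' c hr hx hy h1
    exact ⟨hb, hcol ⟨(r', c + 1), hy⟩ ⟨(r, c + 1), hb⟩ rfl hbl⟩
  · intro r c h
    have := val_ofLabelling e ⟨(r, c), h⟩
    have hlt := (e ⟨(r, c), h⟩).isLt
    change (ofLabelling e).entry r c = _ at this
    omega
  · intro r c r' c' h h' heq
    exact Prod.ext_iff.1 (Subtype.ext_iff.1 (@inj ⟨(r, c), h⟩ ⟨(r', c'), h'⟩ heq))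

/-! ### Sources and sinks -/

theorem mem_des_iff (hτ : τ.IsSPCT σ) {x y : Cell α} (hxy : τ.val y = τ.val x + 1) :
    τ.val x ∈ τ.des ↔ x.1.2 ≤ y.1.2 := by
  constructor
  · rintro ⟨-, -, r, c, r', c', ⟨h1, e1⟩, ⟨h2, e2⟩, hc⟩
    obtain rfl : ⟨(r, c), h1⟩ = x := hτ.val_injective e1
    obtain rfl : ⟨(r', c'), h2⟩ = y := hτ.val_injective (e2.trans hxy.symm)
    exact hc
  · intro hc
    refine ⟨τ.pos _ _ x.2, ?_, _, _, _, _, ⟨x.2, rfl⟩, ⟨y.2, hxy⟩, hc⟩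
    rw [← hxy]
    exact hτ.le_size _ _ y.2

theorem exists_val_eq (hτ : τ.IsSPCT σ) {i : ℕ} (h1 : 1 ≤ i) (h2 : i ≤ n) :
    ∃ x, τ.val x = i :=
  ⟨(labelling hτ).symm ⟨i - 1, by omega⟩, by
    rw [← labelling_add_one hτ, Equiv.apply_symm_apply]
    exact Nat.sub_add_cancel h1⟩

/-- An attacking descent in distinct columns is a step of `Forced τ₀`, because `τ` and `τ₀` agree on
such pairs of cells. -/
theorem isSink_iff (h₀ : τ₀.IsSPCT σ₀) (hτ : τ.IsSPCT σ) (h : ColOrder τ₀ τ) :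
    τ.IsSink ↔ ∀ x y : Cell α, τ.val y = τ.val x + 1 → x.1.2 < y.1.2 → Forced τ₀ x y := by
  constructor
  · intro hs x y hxy hc
    obtain ⟨r, c, r', c', ⟨h1, e1⟩, ⟨h2, e2⟩, hatt⟩ := hs _ ((mem_des_iff hτ hxy).2 hc.le)
    obtain rfl : ⟨(r, c), h1⟩ = x := hτ.val_injective e1
    obtain rfl : ⟨(r', c'), h2⟩ = y := hτ.val_injective (e2.trans hxy.symm)
    obtain ⟨hc', hr⟩ := hatt.resolve_left hc.ne
    exact .inr ⟨lt_of_colOrder hτ h₀ (h.symm h₀.val_injective) hc' hr (by omega),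
      .inr ⟨hc', hr⟩⟩
  · rintro hs i ⟨-, -, r, c, r', c', ⟨h1, rfl⟩, ⟨h2, e2⟩, hc⟩
    refine ⟨r, c, r', c', ⟨h1, rfl⟩, ⟨h2, e2⟩, hc.eq_or_lt.imp id fun hlt => ?_⟩
    rcases hs ⟨(r, c), h1⟩ ⟨(r', c'), h2⟩ e2 hlt with ⟨-, hc'⟩ | ⟨-, hc' | hc'⟩
    · simp only at hc'; omega
    · simp only at hc'; omega
    · exact hc'

/-- The only steps of `Forced τ₀` to a column further left are the row steps, whatever `τ₀` is. -/
theorem isSource_iff (hτ : τ.IsSPCT σ) :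
    τ.IsSource ↔ ∀ x y : Cell α, τ.val y = τ.val x + 1 → y.1.2 < x.1.2 → Forced τ₀ x y := by
  constructor
  · intro hs x y hxy hc
    obtain ⟨r, c, ⟨h1, e1⟩, ⟨h2, e2⟩⟩ := hs (τ.val x) (τ.pos _ _ x.2)
      (hxy ▸ hτ.le_size _ _ y.2) (by rw [mem_des_iff hτ hxy]; omega)
    obtain rfl : ⟨(r, c), h1⟩ = y := hτ.val_injective (e1.trans hxy.symm)
    obtain rfl : ⟨(r, c + 1), h2⟩ = x := hτ.val_injective e2
    exact .inl ⟨rfl, rfl⟩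
  · intro hs i h1 h2 hi
    obtain ⟨x, rfl⟩ := exists_val_eq hτ h1 (by omega)
    obtain ⟨y, hy⟩ := exists_val_eq hτ (i := τ.val x + 1) (by omega) h2
    rw [mem_des_iff hτ hy, not_le] at hi
    rcases hs x y hy hi with ⟨hr, hc⟩ | ⟨-, hc | ⟨hc, -⟩⟩
    · refine ⟨y.1.1, y.1.2, ⟨y.2, hy⟩, ?_⟩
      rw [← hr, ← hc]
      exact ⟨x.2, rfl⟩
    · omega
    · omega

end Filling

open Filling

/-- Unique existence in an equivalence class follows from unique existence among the linear
extensions of `Forced`. -/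
theorem existsUnique_of_labelling {τ₀ : SPCT α} {p : SPCT α → Prop} {q : (Cell α ≃ Fin n) → Prop}
    (hpq : ∀ (τ : SPCT α) (e : Cell α ≃ Fin n), ColOrder τ₀.1 τ.1 →
      (∀ x, τ.1.val x = (e x : ℕ) + 1) → (p τ ↔ q e))
    (he : ∃! e : Cell α ≃ Fin n, (∀ x y, Forced τ₀.1 x y → e x < e y) ∧ q e) :
    ∃! τ : SPCT α, τ.1.st = τ₀.1.st ∧ p τ := by
  obtain ⟨σ₀, h₀⟩ := τ₀.2
  obtain ⟨e, ⟨hmono, hq⟩, huniq⟩ := he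
  obtain ⟨hτ, hcol⟩ := isSPCT_ofLabelling h₀ hmono
  refine ⟨⟨ofLabelling e, σ₀, hτ⟩,
    ⟨((st_eq_iff h₀.val_injective hτ.val_injective).2 hcol).symm,
      (hpq ⟨_, σ₀, hτ⟩ e hcol (val_ofLabelling e)).2 hq⟩, ?_⟩
  rintro ⟨τ, σ, hσ⟩ ⟨hst, hp⟩
  have hc := (st_eq_iff h₀.val_injective hσ.val_injective).1 hst.symm
  have hlab : labelling hσ = e := by
    refine huniq _ ⟨fun x y hxy => ?_,
      (hpq ⟨τ, σ, hσ⟩ _ hc fun x => (labelling_add_one hσ x).symm).1 hp⟩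
    have := (colOrder_iff_forced h₀ hσ).1 hc x y hxy
    rw [← labelling_add_one hσ, ← labelling_add_one hσ] at this
    exact Nat.lt_of_succ_lt_succ this
  refine Subtype.ext (ext_val fun x => ?_)
  rw [val_ofLabelling, ← labelling_add_one hσ, hlab]

theorem exists_linearExtension (τ₀ : SPCT α) :
    ∃ e : Cell α ≃ Fin n, ∀ x y, Forced τ₀.1 x y → e x < e y := by
  obtain ⟨σ₀, h₀⟩ := τ₀.2
  refine ⟨labelling h₀, fun x y hxy => ?_⟩
  have := (colOrder_iff_forced h₀ h₀).1 (fun _ _ _ h => h) x y hxy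
  rw [← labelling_add_one h₀, ← labelling_add_one h₀] at this
  exact Nat.lt_of_succ_lt_succ this

theorem forced_total_of_col_eq (τ₀ : SPCT α) {x y : Cell α} (hc : x.1.2 = y.1.2) (hne : x ≠ y) :
    Forced τ₀.1 x y ∨ Forced τ₀.1 y x := by
  obtain ⟨σ₀, h₀⟩ := τ₀.2
  exact (h₀.val_injective.ne hne).lt_or_gt.imp (fun h => .inr ⟨h, .inl hc⟩)
    fun h => .inr ⟨h, .inl hc.symm⟩

end PermutedTableaux

open PermutedTableaux Filling in
theorem mainTheorem5 {n : ℕ} (α : Composition n)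
    (E : Set (PermutedTableaux.SPCT α)) (hE : E ∈ (PermutedTableaux.stSetoid α).classes) :
    (∃! τ : PermutedTableaux.SPCT α, τ ∈ E ∧ τ.1.IsSource) ∧
      (∃! τ : PermutedTableaux.SPCT α, τ ∈ E ∧ τ.1.IsSink) := by
  obtain ⟨τ₀, rfl⟩ := hE
  constructor
  · -- Negating the columns exchanges left and right.
    refine existsUnique_of_labelling (fun τ e _ he => ?_)
      (existsUnique_extremal (col := fun x : Cell α => -(x.1.2 : ℤ)) (G := Forced τ₀.1)
        (fun x y hc hne => forced_total_of_col_eq τ₀ (by simpa using hc) hne)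
        (fun x y h => by
          rcases h with ⟨-, h⟩ | ⟨-, h | ⟨h, -⟩⟩ <;> simp only [h] <;> push_cast <;> omega)
        (exists_linearExtension τ₀))
    obtain ⟨σ, hσ⟩ := τ.2
    rw [isSource_iff (τ₀ := τ₀.1) hσ]
    simp only [he, add_left_inj, neg_lt_neg_iff, Nat.cast_lt]
  · refine existsUnique_of_labelling (fun τ e hcol he => ?_)
      (existsUnique_extremal (col := fun x : Cell α => (x.1.2 : ℤ)) (G := Forced τ₀.1)
        (fun x y hc hne => forced_total_of_col_eq τ₀ (by simpa using hc) hne)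
        (fun x y h => by
          rcases h with ⟨-, h⟩ | ⟨-, h | ⟨h, -⟩⟩ <;> simp only [h] <;> push_cast <;> omega)
        (exists_linearExtension τ₀))
    obtain ⟨σ, hσ⟩ := τ.2
    obtain ⟨σ₀, h₀⟩ := τ₀.2
    rw [isSink_iff h₀ hσ hcol]
    simp only [he, add_left_inj, Nat.cast_lt]
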